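/- Theorem 1. Consider the single-server queue with infinite buffer and two classes of customers, in which class-$i$ customers arrive in independent Poisson streams of rates $\lambda_1,\lambda_2>0$, all service times are exponential with rate $\mu>0$, and class 1 has non-preemptive priority over class 2: a service in progress is never interrupted, and a server that completes a service next takes a class-1 customer if one is present, otherwise a class-2 customer if one is present. Let $N_i(t)$ be the number of class-$i$ customers in the system at time $t$ and let $\xi(t)\in\{0,1,2\}$ be $0$ if the server is free and $k$ if it is serving a class-$k$ customer; $(N_1,N_2,\xi)$ is the continuous-time Markov process on the states $(0,0,0)$, $(i,j,1)$ with $i\ge 1$, $j\ge 0$, and $(i,j,2)$ with $i\ge 0$, $j\ge 1$, in which class-$i$ arrivals occur at rate $\lambda_i$ and service completions at rate $\mu$ whenever the server is busy. Suppose that $\rho=(\lambda_1+\lambda_2)/\mu<1$. Then there is exactly one probability distribution $(p_{ijk})$ on these states that satisfies the stationary balance equations; for every initial distribution, $\lim_{t\to\infty}\Pr\{N_1(t)=i,\,N_2(t)=j,\,\xi(t)=k\}=p_{ijk}$ for every state $(i,j,k)$; and the steady-state probabilities that the server is occupied by a class-1 customer, is occupied by a class-2 customer, and is free are $$\sum_{i\ge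 1,\,j\ge 0}p_{ij1}=\lim_{t\to\infty}\Pr\{\xi(t)=1\}=\frac{\lambda_1}{\mu},\qquad \sum_{i\ge 0,\,j\ge 1}p_{ij2}=\lim_{t\to\infty}\Pr\{\xi(t)=2\}=\frac{\lambda_2}{\mu},\qquad p_{000}=\lim_{t\to\infty}\Pr\{\xi(t)=0\}=\frac{\mu-\lambda_1-\lambda_2}{\mu}.$$ -/

import Mathlib

open Filter Topology MeasureTheory
open scoped NNReal

namespace PriorityQueue

/-! ### Continuous-time Markov processes on a discrete state space -/

/-- `P` is a (standard, honest) transition function on `S` whose matrix of transition rates is `Q`: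
stochastic matrices `P t`, `t ≥ 0`, with `P 0 = I`, the Chapman-Kolmogorov equations and
`P h = I + h Q + o(h)` entrywise as `h ↓ 0`. -/
structure IsTransitionFunction {S : Type*} [DecidableEq S] (Q : S → S → ℝ)
    (P : ℝ≥0 → S → S → ℝ) : Prop where
  nonneg : ∀ t x y, 0 ≤ P t x y
  hasSum_one : ∀ t x, HasSum (fun y => P t x y) 1
  zero : ∀ x y, P 0 x y = if x = y then 1 else 0
  chapman_kolmogorov : ∀ s t x y, HasSum (fun z => P s x z * P t z y) (P (s + t) x y)
  rates : ∀ x y, Tendsto (fun h : ℝ≥0 => (P h x y - P 0 x y) / (h : ℝ)) (𝓝[>] 0) (𝓝 (Q x y))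

/-- The σ-algebra generated by the process `X` up to and including time `s`. -/
abbrev past {Ω S : Type*} [MeasurableSpace S] (X : ℝ≥0 → Ω → S) (s : ℝ≥0) : MeasurableSpace Ω :=
  ⨆ u : Set.Iic s, MeasurableSpace.comap (X u) inferInstance

/-- `X` is a time-homogeneous Markov process on the discrete space `S` with transition rates `Q`,
with an arbitrary initial law: its conditional law at time `s + t`, given the past up to time `s`,
is `P t (X s) ·`, for a transition function `P` with rates `Q`. -/
def IsMarkovProcess {Ω S : Type*} [MeasurableSpace Ω] [MeasurableSpace S] [DecidableEq S]
    (Q : S → S → ℝ) (ℙ : Measure Ω) (X : ℝ≥0 → Ω → S) : Prop :=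
  (∀ t, Measurable (X t)) ∧
  ∃ P : ℝ≥0 → S → S → ℝ, IsTransitionFunction Q P ∧
    ∀ (s t : ℝ≥0) (x y : S) (A : Set Ω), MeasurableSet[past X s] A →
      ℙ.real (A ∩ {ω | X s ω = x} ∩ {ω | X (s + t) ω = y}) =
        ℙ.real (A ∩ {ω | X s ω = x}) * P t x y

/-- `p` is a probability distribution that satisfies the stationary balance equations `p Q = 0`. -/
structure IsStationaryDistribution {S : Type*} (Q : S → S → ℝ) (p : S → ℝ) : Prop where
  nonneg : ∀ x, 0 ≤ p x
  hasSum_one : HasSum p 1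
  balance : ∀ y, HasSum (fun x => p x * Q x y) 0

/-! ### The queue -/

/-- States `(n₁, n₂, ξ)`: `nᵢ` is the number of class-`i` customers in the system (the one in
service included) and `ξ` is the class of the customer in service, with `ξ = 0` for a free server.
The server is free only if the system is empty, and it serves class `i` only if a class-`i`
customer is present. -/
abbrev State : Type :=
  {s : ℕ × ℕ × Fin 3 //
    (s.2.2 = 0 ∧ s.1 = 0 ∧ s.2.1 = 0) ∨ (s.2.2 = 1 ∧ 1 ≤ s.1) ∨ (s.2.2 = 2 ∧ 1 ≤ s.2.1)}

/-- The number of class-1 customers in the system. -/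
def State.n₁ (s : State) : ℕ := s.1.1

/-- The number of class-2 customers in the system. -/
def State.n₂ (s : State) : ℕ := s.1.2.1

/-- The state of the server: `0` free, `1` serving class 1, `2` serving class 2. -/
def State.ξ (s : State) : Fin 3 := s.1.2.2

/-- The empty system, `(0, 0, 0)`. -/
def empty : State := ⟨(0, 0, 0), Or.inl ⟨rfl, rfl, rfl⟩⟩

/-- The state in which `i` and `j` customers are present and one of class 1 is in service. -/
def serving₁ (i j : ℕ) (h : 1 ≤ i) : State := ⟨(i, j, 1), Or.inr (Or.inl ⟨rfl, h⟩)⟩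

/-- The state in which `i` and `j` customers are present and one of class 2 is in service. -/
def serving₂ (i j : ℕ) (h : 1 ≤ j) : State := ⟨(i, j, 2), Or.inr (Or.inr ⟨rfl, h⟩)⟩

/-- The priority rule: a server that becomes available with `i` and `j` customers present takes a
class-1 customer if there is one, otherwise a class-2 customer if there is one. -/
def startNext (i j : ℕ) : State :=
  if hi : 1 ≤ i then serving₁ i j hi
  else if hj : 1 ≤ j then serving₂ i j hj
  else empty

/-- A class-1 customer arrives. It never interrupts a service in progress. -/
def arrive₁ (s : State) : State :=
  if s.ξ = 1 then serving₁ (s.n₁ + 1) s.n₂ (Nat.le_add_left 1 _)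
  else if h : s.ξ = 2 ∧ 1 ≤ s.n₂ then serving₂ (s.n₁ + 1) s.n₂ h.2
  else startNext (s.n₁ + 1) s.n₂

/-- A class-2 customer arrives. It never interrupts a service in progress. -/
def arrive₂ (s : State) : State :=
  if h : s.ξ = 1 ∧ 1 ≤ s.n₁ then serving₁ s.n₁ (s.n₂ + 1) h.2
  else if s.ξ = 2 then serving₂ s.n₁ (s.n₂ + 1) (Nat.le_add_left 1 _)
  else startNext s.n₁ (s.n₂ + 1)

/-- The service in progress (if any) is completed: the customer leaves and the server proceeds by
the priority rule. -/
def complete (s : State) : State :=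
  if s.ξ = 1 then startNext (s.n₁ - 1) s.n₂
  else if s.ξ = 2 then startNext s.n₁ (s.n₂ - 1)
  else s

/-- The transition rates of the non-preemptive two-class M/M/1 priority queue: class-`i` customers
arrive at rate `lamᵢ` in every state, and a service in progress is completed at rate `mu`. Each
event contributes its rate to the entry of its target state and minus its rate to the diagonal. -/
def rate (lam₁ lam₂ mu : ℝ) (x y : State) : ℝ :=
  lam₁ * ((if y = arrive₁ x then 1 else 0) - (if y = x then 1 else 0)) +
  lam₂ * ((if y = arrive₂ x then 1 else 0) - (if y = x then 1 else 0)) +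
  (if x.ξ = 0 then 0 else mu) * ((if y = complete x then 1 else 0) - (if y = x then 1 else 0))

/-- `X t = (N₁(t), N₂(t), ξ(t))` is the state process of the non-preemptive two-class M/M/1
priority queue with arrival rates `lam₁`, `lam₂` and service rate `mu`. -/
def IsPriorityQueue {Ω : Type*} [MeasurableSpace Ω] (lam₁ lam₂ mu : ℝ) (ℙ : Measure Ω)
    (X : ℝ≥0 → Ω → State) : Prop :=
  IsMarkovProcess (rate lam₁ lam₂ mu) ℙ X

end PriorityQueue

namespace PriorityQueue

/-! ### Sums against kernels -/

/-! Only the defining properties of a transition function `P` with rates `Q` are used; `P` is never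
constructed.

Existence. The uniformized chain `K = 1 + Q/q`, with `q` a bound on all exit rates, has the square
of the total number of customers as a Lyapunov function, because the total arrival rate is below
`mu`. Cesàro averages of `K` are therefore tight, and a limit point is an invariant distribution
(`exists_invariant_of_drift`, `exists_stationary`).

Server. In equilibrium the drift of a bounded function has mean zero. Applied to the class counts
truncated at `m`, with `m → ∞`, this equates `lamᵢ` with `mu` times the probability of serving class
`i` (`hasSum_server`); the rest of the mass sits at `empty`. So every stationary distribution has
the same positive mass there, and positivity spreads along arrivals.

Uniqueness. If `p` and `p'` differ, the normalized `|p' - p|` is again stationary, yet it vanishes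
at `empty` (`stationary_unique`).

Convergence. Bounded rates make `p` invariant under every `P t` (`hasSum_stationary`). The second
moment of `P t · y` under `p` then decreases to a limit, so the variance of each transition tends to
zero (`energy_sub_ge`). This forces `P t z y - P t x y → 0` for all `x` and `z`, and averaging over
`z` gives `P t x y → p y` (`tendsto_of_stationary`). Scheffé's lemma passes from states to events.
-/

theorem summable_kernel {S : Type*} {w f : S → ℝ} {A : S → S → ℝ} {B C : ℝ}
    (hw : Summable w) (hA : ∀ x, Summable fun y => |A x y|) (hC : ∀ x, ∑' y, |A x y| ≤ C)
    (hf : ∀ y, |f y| ≤ B) : Summable fun q : S × S => w q.1 * A q.1 q.2 * f q.2 := by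
  have hle : ∀ x y, |w x * A x y * f y| ≤ |w x| * (|A x y| * B) := fun x y => by
    rw [abs_mul, abs_mul, mul_assoc]
    gcongr
    exact hf y
  have hs : ∀ x, Summable fun y => |w x| * (|A x y| * B) := fun x =>
    ((hA x).mul_right B).mul_left _
  apply Summable.of_abs
  rw [summable_prod_of_nonneg (fun _ => abs_nonneg _)]
  refine ⟨fun x => Summable.of_nonneg_of_le (fun _ => abs_nonneg _) (hle x) (hs x), ?_⟩
  refine Summable.of_nonneg_of_le (fun x => tsum_nonneg fun y => abs_nonneg _) (fun x => ?_)
    (hw.abs.mul_right (C * B))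
  calc ∑' y, |w x * A x y * f y| ≤ ∑' y, |w x| * (|A x y| * B) :=
        (Summable.of_nonneg_of_le (fun _ => abs_nonneg _) (hle x) (hs x)).tsum_le_tsum (hle x) (hs x)
    _ = |w x| * ((∑' y, |A x y|) * B) := by rw [tsum_mul_left, tsum_mul_right]
    _ ≤ |w x| * (C * B) := by
        have hB : 0 ≤ B := (abs_nonneg _).trans (hf x)
        gcongr
        exact hC x

/-- Fubini: the integral of `f` against the image `wA` of `w` under the kernel `A` is the integral
of `Af` against `w`. -/
theorem hasSum_kernel {S : Type*} {w f : S → ℝ} {A : S → S → ℝ} {B C : ℝ}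
    (hw : Summable w) (hA : ∀ x, Summable fun y => |A x y|) (hC : ∀ x, ∑' y, |A x y| ≤ C)
    (hf : ∀ y, |f y| ≤ B) :
    HasSum (fun y => (∑' x, w x * A x y) * f y) (∑' x, w x * ∑' y, A x y * f y) := by
  have h := summable_kernel hw hA hC hf
  have h2 := (Equiv.prodComm S S).summable_iff.mpr h
  have h3 := h2.hasSum.prod_fiberwise (fun y => (h2.prod_factor y).hasSum)
  have e : ∑' q, ((fun q : S × S => w q.1 * A q.1 q.2 * f q.2) ∘ Equiv.prodComm S S) q =
      ∑' x, w x * ∑' y, A x y * f y := by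
    refine ((Equiv.prodComm S S).tsum_eq fun q : S × S => w q.1 * A q.1 q.2 * f q.2).trans ?_
    rw [h.tsum_prod]
    simp only [mul_assoc, tsum_mul_left]
  rw [e] at h3
  simpa [tsum_mul_right] using h3

/-! ### Convergence of probability distributions -/

/-- Scheffé's lemma on a discrete space: pointwise convergence of probability distributions implies
convergence of the probabilities of all events. -/
theorem tendsto_of_hasSum_indicator {S ι : Type*} {l : Filter ι} {u : ι → S → ℝ} {p : S → ℝ}
    (hu0 : ∀ t s, 0 ≤ u t s) (hu1 : ∀ t, HasSum (u t) 1) (hp0 : ∀ s, 0 ≤ p s) (hp1 : HasSum p 1)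
    (hup : ∀ s, Tendsto (fun t => u t s) l (𝓝 (p s))) (A : Set S) {U : ι → ℝ} {a : ℝ}
    (hU : ∀ t, HasSum (A.indicator (u t)) (U t)) (ha : HasSum (A.indicator p) a) :
    Tendsto U l (𝓝 a) := by
  -- The minimum is dominated by `p`, and `|u - p| = u + p - 2 min(u, p)` turns convergence of its
  -- mass into convergence in total variation.
  have hm : Tendsto (fun t => ∑' s, min (u t s) (p s)) l (𝓝 (∑' s, p s)) := by
    refine tendsto_tsum_of_dominated_convergence (bound := p) hp1.summable (fun s => ?_)
      (Eventually.of_forall fun t s => ?_)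
    · simpa using (hup s).min (tendsto_const_nhds (x := p s))
    · rw [Real.norm_of_nonneg (le_min (hu0 t s) (hp0 s))]
      exact min_le_right _ _
  rw [hp1.tsum_eq] at hm
  rw [tendsto_iff_norm_sub_tendsto_zero]
  refine squeeze_zero (g := fun t => 2 - 2 * ∑' s, min (u t s) (p s)) (fun t => norm_nonneg _)
    (fun t => ?_) ?_
  · have hms : Summable fun s => min (u t s) (p s) :=
      Summable.of_nonneg_of_le (fun s => le_min (hu0 t s) (hp0 s)) (fun s => min_le_right _ _)
        hp1.summable
    have h1 : HasSum (fun s => u t s + p s - 2 * min (u t s) (p s))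
        (1 + 1 - 2 * ∑' s, min (u t s) (p s)) :=
      ((hu1 t).add hp1).sub (hms.hasSum.mul_left 2)
    have h2 := (hU t).sub ha
    have hle : ∀ s, ‖A.indicator (u t) s - A.indicator p s‖ ≤ u t s + p s - 2 * min (u t s) (p s) := by
      intro s
      rw [Real.norm_eq_abs]
      by_cases hs : s ∈ A
      · simp only [Set.indicator_of_mem hs]
        rcases le_total (u t s) (p s) with h | h
        · rw [min_eq_left h, abs_of_nonpos (by linarith)]; linarith
        · rw [min_eq_right h, abs_of_nonneg (by linarith)]; linarith
      · simp only [Set.indicator_of_notMem hs]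
        have := min_le_left (u t s) (p s)
        have := min_le_right (u t s) (p s)
        simp only [sub_zero, abs_zero]
        linarith
    have := tsum_of_norm_bounded h1 hle
    rw [h2.tsum_eq] at this
    exact this.trans (by linarith)
  · have := (hm.const_mul 2).const_sub 2
    simpa using this

/-! ### Transition functions -/

namespace IsTransitionFunction

variable {S : Type*} [DecidableEq S] {Q : S → S → ℝ} {P : ℝ≥0 → S → S → ℝ}

theorem le_one (hP : IsTransitionFunction Q P) (t : ℝ≥0) (x y : S) : P t x y ≤ 1 :=
  le_hasSum (hP.hasSum_one t x) y fun z _ => hP.nonneg t x z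

theorem abs_le_one (hP : IsTransitionFunction Q P) (t : ℝ≥0) (x y : S) : |P t x y| ≤ 1 := by
  rw [abs_of_nonneg (hP.nonneg t x y)]
  exact hP.le_one t x y

theorem summable_abs (hP : IsTransitionFunction Q P) (t : ℝ≥0) (x : S) :
    Summable fun y => |P t x y| := (hP.hasSum_one t x).summable.abs

theorem tsum_abs (hP : IsTransitionFunction Q P) (t : ℝ≥0) (x : S) :
    ∑' y, |P t x y| = 1 := by
  simp_rw [abs_of_nonneg (hP.nonneg t x _)]
  exact (hP.hasSum_one t x).tsum_eq

theorem hasSum_kernel (hP : IsTransitionFunction Q P) {w f : S → ℝ} {B : ℝ} (hw : Summable w)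
    (hf : ∀ y, |f y| ≤ B) (t : ℝ≥0) :
    HasSum (fun y => (∑' x, w x * P t x y) * f y) (∑' x, w x * ∑' y, P t x y * f y) :=
  PriorityQueue.hasSum_kernel hw (hP.summable_abs t) (fun x => (hP.tsum_abs t x).le) hf

theorem mul_le_add (hP : IsTransitionFunction Q P) (s t : ℝ≥0) (x y z : S) :
    P s x z * P t z y ≤ P (s + t) x y :=
  le_hasSum (hP.chapman_kolmogorov s t x y) z fun _ _ =>
    mul_nonneg (hP.nonneg _ _ _) (hP.nonneg _ _ _)

theorem pow_le_nsmul (hP : IsTransitionFunction Q P) (t : ℝ≥0) (x : S) (n : ℕ) :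
    P t x x ^ n ≤ P (n • t) x x := by
  induction n with
  | zero => simp [hP.zero]
  | succ n ih =>
    rw [pow_succ, succ_nsmul]
    exact (mul_le_mul_of_nonneg_right ih (hP.nonneg _ _ _)).trans (hP.mul_le_add _ _ _ _ _)

theorem tendsto_div_nat_nhdsGT {t : ℝ≥0} (ht : 0 < t) :
    Tendsto (fun n : ℕ => t / n) atTop (𝓝[>] 0) := by
  rw [tendsto_nhdsWithin_iff]
  refine ⟨?_, ?_⟩
  · rw [← NNReal.tendsto_coe]
    push_cast
    exact tendsto_const_div_atTop_nhds_zero_nat (t : ℝ)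
  · filter_upwards [eventually_gt_atTop 0] with n hn
    exact div_pos ht (Nat.cast_pos.mpr hn)

/-- Staying at `x` at all multiples of `t / n` gives `P (t/n) x x ^ n ≤ P t x x`, and the left side
tends to the exponential. The resulting bounds hold for all `t`, with constants uniform in `x` once
the rates are bounded. -/
theorem exp_le_diag (hP : IsTransitionFunction Q P) (t : ℝ≥0) (x : S) :
    Real.exp (Q x x * t) ≤ P t x x := by
  rcases eq_or_ne t 0 with rfl | ht
  · simp [hP.zero]
  have ht : 0 < t := pos_iff_ne_zero.mpr ht
  have h1 : Tendsto (fun n : ℕ => (n : ℝ) * (P (t / n) x x - 1)) atTop (𝓝 (Q x x * t)) := by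
    refine (((hP.rates x x).comp (tendsto_div_nat_nhdsGT ht)).mul_const (t : ℝ)).congr' ?_
    filter_upwards [eventually_gt_atTop 0] with n hn
    have : (n : ℝ) ≠ 0 := by positivity
    have : (t : ℝ) ≠ 0 := by exact_mod_cast ht.ne'
    simp only [Function.comp, hP.zero, if_true]
    push_cast
    field_simp
  refine le_of_tendsto (Real.tendsto_one_add_pow_exp_of_tendsto h1) ?_
  filter_upwards [eventually_gt_atTop 0] with n hn
  have := hP.pow_le_nsmul (t / n) x n
  have e : n • (t / n) = t := by
    rw [nsmul_eq_mul, mul_div_cancel₀]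
    positivity
  rw [e] at this
  rwa [add_sub_cancel]

theorem diag_pos (hP : IsTransitionFunction Q P) (t : ℝ≥0) (x : S) : 0 < P t x x :=
  (Real.exp_pos _).trans_le (hP.exp_le_diag t x)

theorem one_sub_diag_le (hP : IsTransitionFunction Q P) {q : ℝ} (hq : ∀ x, -Q x x ≤ q) (t : ℝ≥0)
    (x : S) : 1 - P t x x ≤ q * t := by
  have h1 := hP.exp_le_diag t x
  have h2 := Real.add_one_le_exp (Q x x * t)
  have h3 := mul_le_mul_of_nonneg_right (hq x) t.coe_nonneg
  linarith

/-- Rows sum to one, so an off-diagonal entry is at most `1 - P t x x`. This bound dominates the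
difference quotients in `tendsto_stationary_div`. -/
theorem abs_sub_zero_le (hP : IsTransitionFunction Q P) {q : ℝ} (hq : ∀ x, -Q x x ≤ q) (t : ℝ≥0)
    (x y : S) : |P t x y - P 0 x y| ≤ q * t := by
  refine le_trans ?_ (hP.one_sub_diag_le hq t x)
  rw [hP.zero]
  split_ifs with h
  · subst h
    rw [abs_sub_comm, abs_of_nonneg (sub_nonneg.mpr (hP.le_one _ _ _))]
  · rw [sub_zero, abs_of_nonneg (hP.nonneg _ _ _)]
    have := (hP.hasSum_one t x).summable.sum_le_tsum {x, y} fun z _ => hP.nonneg t x z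
    rw [(hP.hasSum_one t x).tsum_eq, Finset.sum_pair h] at this
    linarith

theorem summable_mul (hP : IsTransitionFunction Q P) {w : S → ℝ} (hw : Summable w) (t : ℝ≥0)
    (y : S) : Summable fun x => w x * P t x y := by
  refine Summable.of_norm_bounded hw.abs fun x => ?_
  rw [Real.norm_eq_abs, abs_mul]
  exact mul_le_of_le_one_right (abs_nonneg _) (hP.abs_le_one t x y)

theorem hasSum_image (hP : IsTransitionFunction Q P) {w : S → ℝ} {a : ℝ} (hw : HasSum w a)
    (t : ℝ≥0) : HasSum (fun y => ∑' x, w x * P t x y) a := by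
  have h := hP.hasSum_kernel (f := fun _ => 1) (B := 1) hw.summable (by simp) t
  simpa [(hP.hasSum_one t _).tsum_eq, hw.tsum_eq] using h

/-- In a short time `h` a stationary distribution moves by `o(h)` in total variation. -/
theorem tendsto_stationary_div (hP : IsTransitionFunction Q P) {q : ℝ} (hq : ∀ x, -Q x x ≤ q)
    {p : S → ℝ} (hp : IsStationaryDistribution Q p) :
    Tendsto (fun h : ℝ≥0 => (∑' y, |(∑' x, p x * P h x y) - p y|) / h) (𝓝[>] 0) (𝓝 0) := by
  have hps := hp.hasSum_one.summable
  have hr : ∀ y, Tendsto (fun h : ℝ≥0 => ((∑' x, p x * P h x y) - p y) / h) (𝓝[>] 0) (𝓝 0) := by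
    intro y
    have h1 : Tendsto (fun h : ℝ≥0 => ∑' x, p x * ((P h x y - P 0 x y) / h)) (𝓝[>] 0)
        (𝓝 (∑' x, p x * Q x y)) := by
      refine tendsto_tsum_of_dominated_convergence (bound := fun x => p x * q) (hps.mul_right q)
        (fun x => (hP.rates x y).const_mul _) ?_
      filter_upwards [self_mem_nhdsWithin] with h hh x
      have hh' : (0 : ℝ) < h := by exact_mod_cast hh
      rw [norm_mul, Real.norm_of_nonneg (hp.nonneg x), norm_div, Real.norm_eq_abs,
        Real.norm_of_nonneg hh'.le]
      refine mul_le_mul_of_nonneg_left ?_ (hp.nonneg x)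
      rw [div_le_iff₀ hh']
      exact hP.abs_sub_zero_le hq h x y
    rw [(hp.balance y).tsum_eq] at h1
    refine h1.congr fun h => ?_
    have h2 : HasSum (fun x => p x * P 0 x y) (p y) := by
      simp only [hP.zero, mul_ite, mul_one, mul_zero]
      refine (hasSum_ite_eq y (p y)).congr_fun fun x => ?_
      split_ifs with hx
      · rw [hx]
      · rfl
    rw [← h2.tsum_eq, ← (hP.summable_mul hps h y).tsum_sub (hP.summable_mul hps 0 y), ← tsum_div_const]
    refine tsum_congr fun x => ?_
    ring
  -- The change `pP_h - p` has total mass zero, so its l¹ norm is twice that of its negative part.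
  -- The negative part is at most `p y * (1 - P h y y)`, hence dominated after division by `h`; the
  -- positive part has no such evident bound.
  have hneg : Tendsto (fun h : ℝ≥0 => ∑' y, max 0 (-(((∑' x, p x * P h x y) - p y) / h)))
      (𝓝[>] 0) (𝓝 (∑' _ : S, 0)) := by
    refine tendsto_tsum_of_dominated_convergence (bound := fun x => p x * q) (hps.mul_right q)
      (fun y => ?_) ?_
    · simpa using (tendsto_const_nhds (x := (0 : ℝ))).max (hr y).neg
    filter_upwards [self_mem_nhdsWithin] with h hh y
    have hh' : (0 : ℝ) < h := by exact_mod_cast hh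
    have h0 := hP.one_sub_diag_le hq h y
    have hq0 : 0 ≤ q * h := (sub_nonneg.mpr (hP.le_one h y y)).trans h0
    rw [Real.norm_of_nonneg (le_max_left _ _)]
    refine max_le (mul_nonneg (hp.nonneg y) (nonneg_of_mul_nonneg_left hq0 hh')) ?_
    rw [← neg_div, div_le_iff₀ hh', neg_sub]
    have h1 : p y * P h y y ≤ ∑' x, p x * P h x y :=
      (hP.summable_mul hps h y).le_tsum y fun x _ => mul_nonneg (hp.nonneg x) (hP.nonneg _ _ _)
    have h2 := mul_le_mul_of_nonneg_left h0 (hp.nonneg y)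
    linarith
  rw [tsum_zero] at hneg
  have h2 := hneg.const_mul 2
  rw [mul_zero] at h2
  refine h2.congr' ?_
  filter_upwards [self_mem_nhdsWithin] with h hh
  have hh' : (0 : ℝ) < h := by exact_mod_cast hh
  have hd : HasSum (fun y => (∑' x, p x * P h x y) - p y) 0 := by
    simpa using (hP.hasSum_image hp.hasSum_one h).sub hp.hasSum_one
  rw [← tsum_div_const]
  have hr0 : HasSum (fun y => ((∑' x, p x * P h x y) - p y) / h) 0 := by
    simpa using hd.div_const (h : ℝ)
  have key : ∀ y, 2 * max 0 (-(((∑' x, p x * P h x y) - p y) / h)) =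
      |(∑' x, p x * P h x y) - p y| / h - ((∑' x, p x * P h x y) - p y) / h := by
    intro y
    rw [← abs_of_pos hh', ← abs_div, abs_of_pos hh']
    generalize ((∑' x, p x * P h x y) - p y) / h = r
    rcases le_total 0 r with h | h
    · rw [max_eq_left (by linarith), abs_of_nonneg h]; ring
    · rw [max_eq_right (by linarith), abs_of_nonpos h]; ring
  rw [← tsum_mul_left, tsum_congr key, Summable.tsum_sub (hd.summable.abs.div_const _) hr0.summable,
    hr0.tsum_eq, sub_zero]

/-- With bounded rates, a distribution that satisfies the balance equations is invariant under the
transition function. -/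
theorem hasSum_stationary (hP : IsTransitionFunction Q P) {q : ℝ} (hq : ∀ x, -Q x x ≤ q)
    {p : S → ℝ} (hp : IsStationaryDistribution Q p) (t : ℝ≥0) (y : S) :
    HasSum (fun x => p x * P t x y) (p y) := by
  have hps := hp.hasSum_one.summable
  suffices h : ∑' x, p x * P t x y = p y by
    rw [← h]; exact (hP.summable_mul hps t y).hasSum
  rcases eq_or_ne t 0 with rfl | ht
  · simp [hP.zero]
  have ht : 0 < t := pos_iff_ne_zero.mpr ht
  -- Applying `P s` to the signed measure `pP_h - p` gives at `y` at most its l¹ norm, since the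
  -- entries of `P s` are bounded by one.
  have hstep : ∀ s h : ℝ≥0, |(∑' x, p x * P (h + s) x y) - ∑' x, p x * P s x y| ≤
      ∑' z, |(∑' x, p x * P h x z) - p z| := by
    intro s h
    have h1 := hP.hasSum_kernel hps (fun z => hP.abs_le_one s z y) h
    simp only [(hP.chapman_kolmogorov h s _ y).tsum_eq] at h1
    have h2 := h1.sub (hP.summable_mul hps s y).hasSum
    have hd := (hP.hasSum_image hp.hasSum_one h).sub hp.hasSum_one
    rw [← h2.tsum_eq, ← Real.norm_eq_abs]
    refine tsum_of_norm_bounded hd.summable.abs.hasSum fun z => ?_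
    rw [← sub_mul, norm_mul]
    exact mul_le_of_le_one_right (abs_nonneg _) (hP.abs_le_one s z y)
  have hn : ∀ (h : ℝ≥0) (n : ℕ), |(∑' x, p x * P (n • h) x y) - p y| ≤
      n * ∑' z, |(∑' x, p x * P h x z) - p z| := by
    intro h n
    induction n with
    | zero => simp [hP.zero]
    | succ n ih =>
      have := abs_add_le ((∑' x, p x * P (h + n • h) x y) - ∑' x, p x * P (n • h) x y)
        ((∑' x, p x * P (n • h) x y) - p y)
      rw [succ_nsmul', Nat.cast_succ]
      rw [sub_add_sub_cancel] at this
      linarith [hstep (n • h) h]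
  -- With `n` steps of length `t / n` the total error is `n * o(t / n)`, which vanishes.
  have hlim := ((hP.tendsto_stationary_div hq hp).comp (tendsto_div_nat_nhdsGT ht)).const_mul (t : ℝ)
  rw [mul_zero] at hlim
  refine sub_eq_zero.mp (abs_eq_zero.mp (le_antisymm ?_ (abs_nonneg _)))
  refine ge_of_tendsto hlim ?_
  filter_upwards [eventually_gt_atTop 0] with n hn0
  have := hn (t / n) n
  have e : n • (t / n) = t := by
    rw [nsmul_eq_mul, mul_div_cancel₀]
    positivity
  rw [e] at this
  refine this.trans (le_of_eq ?_)
  have : (n : ℝ) ≠ 0 := by positivity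
  have : (t : ℝ) ≠ 0 := by exact_mod_cast ht.ne'
  simp only [Function.comp]
  push_cast
  field_simp

/-! ### Convergence to equilibrium by decay of the second moment. -/

theorem exists_pos_of_rate_pos (hP : IsTransitionFunction Q P) {x y : S} (h : 0 < Q x y) :
    ∃ s, 0 < P s x y := by
  have h1 := ((hP.rates x y).eventually (lt_mem_nhds h)).and self_mem_nhdsWithin
  obtain ⟨s, hs, hs0⟩ := h1.exists
  have hs' : (0 : ℝ) < s := by exact_mod_cast hs0
  refine ⟨s, ?_⟩
  have := (div_pos_iff_of_pos_right hs').mp hs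
  have h0 := hP.nonneg 0 x y
  linarith

/-- The second moment of `P t · y` under a stationary distribution decreases in `t`, at least by
the variance of each transition. -/
theorem energy_sub_ge (hP : IsTransitionFunction Q P) {p : S → ℝ} (hp0 : ∀ x, 0 ≤ p x)
    (hps : Summable p) (hst : ∀ t y, HasSum (fun x => p x * P t x y) (p y)) (s t : ℝ≥0)
    (x z y : S) :
    p x * (P s x z * (P t z y - P (s + t) x y) ^ 2) ≤
      (∑' x, p x * P t x y ^ 2) - ∑' x, p x * P (s + t) x y ^ 2 := by
  have hb : ∀ t z, |P t z y ^ 2| ≤ 1 := fun t z => by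
    rw [abs_pow]
    exact pow_le_one₀ (abs_nonneg _) (hP.abs_le_one t z y)
  have hsq : ∀ x, Summable fun z => P s x z * P t z y ^ 2 := fun x => by
    refine Summable.of_norm_bounded (hP.hasSum_one s x).summable fun z => ?_
    rw [norm_mul, Real.norm_of_nonneg (hP.nonneg _ _ _)]
    exact mul_le_of_le_one_right (hP.nonneg _ _ _) (hb t z)
  -- `P (s + t) x y` is the mean of `P t · y` under `P s x ·`, so this is the usual formula for a
  -- variance.
  have hvar : ∀ x, HasSum (fun z => P s x z * (P t z y - P (s + t) x y) ^ 2)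
      ((∑' z, P s x z * P t z y ^ 2) - P (s + t) x y ^ 2) := by
    intro x
    have h := ((hsq x).hasSum.sub ((hP.chapman_kolmogorov s t x y).mul_left (2 * P (s + t) x y))).add
      ((hP.hasSum_one s x).mul_left (P (s + t) x y ^ 2))
    have e : (∑' z, P s x z * P t z y ^ 2) - P (s + t) x y ^ 2 =
        (∑' z, P s x z * P t z y ^ 2) - 2 * P (s + t) x y * P (s + t) x y +
          P (s + t) x y ^ 2 * 1 := by ring
    rw [e]
    refine h.congr_fun fun z => ?_
    ring
  have hvar0 : ∀ x z, 0 ≤ P s x z * (P t z y - P (s + t) x y) ^ 2 := fun x z =>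
    mul_nonneg (hP.nonneg _ _ _) (sq_nonneg _)
  have h1 := hP.hasSum_kernel hps (hb t) s
  simp only [(hst s _).tsum_eq] at h1
  have hs1 : Summable fun x => p x * ∑' z, P s x z * P t z y ^ 2 := by
    refine Summable.of_norm_bounded hps fun x => ?_
    rw [norm_mul, Real.norm_of_nonneg (hp0 x)]
    refine mul_le_of_le_one_right (hp0 x) ?_
    rw [← (hP.hasSum_one s x).tsum_eq]
    refine tsum_of_norm_bounded (hP.hasSum_one s x).summable.hasSum fun z => ?_
    rw [norm_mul, Real.norm_of_nonneg (hP.nonneg _ _ _)]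
    exact mul_le_of_le_one_right (hP.nonneg _ _ _) (hb t z)
  have hs2 : Summable fun x => p x * P (s + t) x y ^ 2 := by
    refine Summable.of_norm_bounded hps fun x => ?_
    rw [norm_mul, Real.norm_of_nonneg (hp0 x)]
    exact mul_le_of_le_one_right (hp0 x) (hb _ x)
  rw [h1.tsum_eq, ← hs1.tsum_sub hs2]
  refine le_trans ?_ ((hs1.sub hs2).le_tsum x fun w _ => ?_)
  · rw [← mul_sub, ← (hvar x).tsum_eq]
    exact mul_le_mul_of_nonneg_left ((hvar x).summable.le_tsum z fun w _ => hvar0 x w) (hp0 x)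
  · rw [← mul_sub, ← (hvar w).tsum_eq]
    exact mul_nonneg (hp0 w) (tsum_nonneg (hvar0 w))

/-- The second moment is nonincreasing in `t` and nonnegative, so it has a limit and its increments
over a fixed time `s` vanish. -/
theorem tendsto_energy_sub (hP : IsTransitionFunction Q P) {p : S → ℝ} (hp0 : ∀ x, 0 ≤ p x)
    (hps : Summable p) (hst : ∀ t y, HasSum (fun x => p x * P t x y) (p y)) (s : ℝ≥0) (y : S) :
    Tendsto (fun t => (∑' x, p x * P t x y ^ 2) - ∑' x, p x * P (s + t) x y ^ 2) atTop (𝓝 0) := by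
  have hanti : Antitone fun t => ∑' x, p x * P t x y ^ 2 := by
    intro t u htu
    obtain ⟨s, rfl⟩ := exists_add_of_le htu
    have h := hP.energy_sub_ge hp0 hps hst s t y y y
    have h0 : 0 ≤ p y * (P s y y * (P t y y - P (s + t) y y) ^ 2) :=
      mul_nonneg (hp0 y) (mul_nonneg (hP.nonneg _ _ _) (sq_nonneg _))
    rw [add_comm t s]
    exact sub_nonneg.mp (h0.trans h)
  have hbdd : BddBelow (Set.range fun t => ∑' x, p x * P t x y ^ 2) :=
    ⟨0, by
      rintro _ ⟨t, rfl⟩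
      exact tsum_nonneg fun x => mul_nonneg (hp0 x) (sq_nonneg _)⟩
  have h := tendsto_atTop_ciInf hanti hbdd
  have h2 := h.comp (tendsto_atTop_mono (fun t => le_add_of_nonneg_left s.2) tendsto_id :
    Tendsto (fun t : ℝ≥0 => s + t) atTop atTop)
  rw [← sub_self (⨅ t, ∑' x, p x * P t x y ^ 2)]
  exact h.sub h2

/-- The ergodic theorem for an irreducible transition function with an invariant distribution. -/
theorem tendsto_of_stationary (hP : IsTransitionFunction Q P) {p : S → ℝ} (hp0 : ∀ x, 0 < p x)
    (hp1 : HasSum p 1) (hst : ∀ t y, HasSum (fun x => p x * P t x y) (p y))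
    (hconn : ∀ x z, Relation.EqvGen (fun a b => 0 < Q a b) x z) (x y : S) :
    Tendsto (fun t => P t x y) atTop (𝓝 (p y)) := by
  have hp0' : ∀ x, 0 ≤ p x := fun x => (hp0 x).le
  have hmove : ∀ s x z, 0 < P s x z →
      Tendsto (fun t => P t z y - P (s + t) x y) atTop (𝓝 0) := by
    intro s x z hs
    have hc : 0 < p x * P s x z := mul_pos (hp0 x) hs
    have h := (hP.tendsto_energy_sub hp0' hp1.summable hst s y).div_const (p x * P s x z)
    rw [zero_div] at h
    have hsq : Tendsto (fun t => (P t z y - P (s + t) x y) ^ 2) atTop (𝓝 0) := by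
      refine squeeze_zero (fun t => sq_nonneg _) (fun t => ?_) h
      rw [le_div_iff₀ hc]
      have := hP.energy_sub_ge hp0' hp1.summable hst s t x z y
      linarith
    rw [tendsto_zero_iff_abs_tendsto_zero]
    have := (Real.continuous_sqrt.tendsto 0).comp hsq
    simpa [Function.comp_def, Real.sqrt_sq_eq_abs] using this
  -- Taking `z = x` in `hmove` is allowed because diagonal entries are positive (no periodicity);
  -- subtracting removes the shifted time `s + t`. The conclusion is symmetric and transitive in the
  -- two states, so connection by undirected edges suffices.
  have hall : ∀ x z, Tendsto (fun t => P t z y - P t x y) atTop (𝓝 0) := by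
    intro x z
    induction hconn x z with
    | rel a b hab =>
      obtain ⟨s, hs⟩ := hP.exists_pos_of_rate_pos hab
      simpa using (hmove s a b hs).sub (hmove s a a (hP.diag_pos s a))
    | refl a => simp
    | symm a b _ ih => simpa using ih.neg
    | trans a b c _ _ ih1 ih2 => simpa using ih1.add ih2
  have h1 : Tendsto (fun t => ∑' z, p z * (P t z y - P t x y)) atTop (𝓝 (∑' _ : S, 0)) := by
    refine tendsto_tsum_of_dominated_convergence (bound := fun z => p z) hp1.summable
      (fun z => ?_) (Eventually.of_forall fun t z => ?_)
    · simpa using (hall x z).const_mul (p z)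
    · rw [norm_mul, Real.norm_of_nonneg (hp0' z)]
      refine mul_le_of_le_one_right (hp0' z) ?_
      rw [Real.norm_eq_abs, abs_le]
      constructor <;> linarith [hP.nonneg t z y, hP.nonneg t x y, hP.le_one t z y, hP.le_one t x y]
  have h2 : ∀ t, ∑' z, p z * (P t z y - P t x y) = p y - P t x y := fun t => by
    have := ((hst t y).sub (hp1.mul_right (P t x y))).tsum_eq
    rw [one_mul] at this
    rw [← this]
    exact tsum_congr fun z => by ring
  simp only [h2, tsum_zero] at h1
  simpa using h1.const_sub (p y)

end IsTransitionFunction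

/-! ### Existence of invariant distributions under a drift condition -/

theorem markovOperator_pow_mono {S : Type*} {K : (S → ℝ) →ₗ[ℝ] (S → ℝ)}
    (hmono : ∀ f g, f ≤ g → K f ≤ K g) (k : ℕ) {f g : S → ℝ} (h : f ≤ g) :
    (K ^ k) f ≤ (K ^ k) g := by
  induction k generalizing f g with
  | zero => simpa using h
  | succ k ih =>
    rw [pow_succ, Module.End.mul_apply, Module.End.mul_apply]
    exact ih (hmono _ _ h)

theorem markovOperator_pow_one {S : Type*} {K : (S → ℝ) →ₗ[ℝ] (S → ℝ)} (hone : K 1 = 1) (k : ℕ) :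
    (K ^ k) 1 = 1 := by
  induction k with
  | zero => simp
  | succ k ih => rw [pow_succ, Module.End.mul_apply, hone, ih]

/-- The average of `f` over the first `n` steps of the chain with transition operator `K` that is
started at `x`. -/
noncomputable def cesaro {S : Type*} (K : (S → ℝ) →ₗ[ℝ] (S → ℝ)) (x : S) (n : ℕ) :
    (S → ℝ) →ₗ[ℝ] ℝ :=
  (n : ℝ)⁻¹ • ∑ k ∈ Finset.range n, LinearMap.proj x ∘ₗ (K ^ k)

section Cesaro

variable {S : Type*} {K : (S → ℝ) →ₗ[ℝ] (S → ℝ)} {x : S}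

theorem cesaro_apply (n : ℕ) (f : S → ℝ) :
    cesaro K x n f = (n : ℝ)⁻¹ * ∑ k ∈ Finset.range n, (K ^ k) f x := by
  simp [cesaro, LinearMap.sum_apply]

theorem cesaro_mono (hmono : ∀ f g, f ≤ g → K f ≤ K g) (n : ℕ) {f g : S → ℝ} (h : f ≤ g) :
    cesaro K x n f ≤ cesaro K x n g := by
  rw [cesaro_apply, cesaro_apply]
  gcongr with k
  exact markovOperator_pow_mono hmono k h x

theorem cesaro_one (hone : K 1 = 1) {n : ℕ} (hn : n ≠ 0) : cesaro K x n 1 = 1 := by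
  simp [cesaro_apply, markovOperator_pow_one hone, hn]

/-- Telescoping. It serves twice: for `V` it bounds the average of `W`, and for indicators it makes
the limit invariant. -/
theorem cesaro_sub (n : ℕ) (f : S → ℝ) :
    cesaro K x n (K f) - cesaro K x n f = (n : ℝ)⁻¹ * ((K ^ n) f x - f x) := by
  rw [cesaro_apply, cesaro_apply, ← mul_sub, ← Finset.sum_sub_distrib]
  congr 1
  have := Finset.sum_range_sub (fun k => (K ^ k) f x) n
  simpa [pow_succ] using this

end Cesaro

/-- A Markov chain with a Lyapunov function `V`, whose drift is at most `C - W` with `W` of finite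
sublevel sets, has an invariant distribution. -/
theorem exists_invariant_of_drift {S : Type*} [DecidableEq S] {K : (S → ℝ) →ₗ[ℝ] (S → ℝ)}
    (hmono : ∀ f g, f ≤ g → K f ≤ K g) (hone : K 1 = 1) {V W : S → ℝ} {C : ℝ} (hV : 0 ≤ V)
    (hW : 0 ≤ W) (hdrift : ∀ x, K V x ≤ V x - W x + C) (hfin : ∀ m : ℝ, {x | W x ≤ m}.Finite)
    (hcol : ∀ y, (Function.support (K (Pi.single y 1))).Finite) (x₀ : S) :
    ∃ p : S → ℝ, (∀ x, 0 ≤ p x) ∧ HasSum p 1 ∧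
      ∀ y, HasSum (fun x => p x * K (Pi.single y 1) x) (p y) := by
  have hs0 : ∀ y : S, (0 : S → ℝ) ≤ Pi.single y 1 := fun y => by simp
  have hs1 : ∀ y : S, (Pi.single y 1 : S → ℝ) ≤ 1 := fun y x => by
    rw [Pi.single_apply]
    split_ifs <;> simp
  have hmem : ∀ n y, cesaro K x₀ n (Pi.single y 1) ∈ Set.Icc (0 : ℝ) 1 := by
    intro n y
    rcases eq_or_ne n 0 with rfl | hn
    · simp [cesaro_apply]
    · refine ⟨?_, ?_⟩
      · simpa using cesaro_mono (x := x₀) hmono n (hs0 y)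
      · exact (cesaro_mono hmono n (hs1 y)).trans (cesaro_one hone hn).le
  -- Limits along a fixed ultrafilter exist for all states at once, in place of a diagonal
  -- subsequence.
  have hlim : ∀ y, ∃ a ∈ Set.Icc (0 : ℝ) 1,
      Tendsto (fun n => cesaro K x₀ n (Pi.single y 1)) (hyperfilter ℕ) (𝓝 a) := fun y =>
    isCompact_Icc.ultrafilter_le_nhds ((hyperfilter ℕ).map fun n => cesaro K x₀ n (Pi.single y 1))
      (le_principal_iff.mpr (Filter.mem_map.mpr (Eventually.of_forall fun n => hmem n y)))
  choose p hp01 hp using hlim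
  have hU : ((hyperfilter ℕ : Ultrafilter ℕ) : Filter ℕ) ≤ atTop := Nat.hyperfilter_le_atTop
  have hn0 : ∀ᶠ n in (hyperfilter ℕ : Filter ℕ), n ≠ 0 := hU (eventually_ne_atTop 0)
  have hcomb : ∀ (F : Finset S) (c : S → ℝ),
      Tendsto (fun n => cesaro K x₀ n (∑ y ∈ F, c y • Pi.single y 1)) (hyperfilter ℕ)
        (𝓝 (∑ y ∈ F, c y * p y)) := by
    intro F c
    simp only [map_sum, map_smul, smul_eq_mul]
    exact tendsto_finsetSum _ fun y _ => (hp y).const_mul _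
  have hsingle : ∀ (F : Finset S) (c : S → ℝ) (x : S),
      (∑ y ∈ F, c y • (Pi.single y 1 : S → ℝ)) x = if x ∈ F then c x else 0 := by
    intro F c x
    simp [Finset.sum_apply, Pi.single_apply]
  have hle : ∀ F : Finset S, ∑ y ∈ F, p y ≤ 1 := by
    intro F
    have h := hcomb F 1
    simp only [Pi.one_apply, one_mul] at h
    refine le_of_tendsto h ?_
    filter_upwards [hn0] with n hn
    refine (cesaro_mono hmono n fun x => ?_).trans (cesaro_one hone hn).le
    have := hsingle F 1 x
    simp only [Pi.one_apply] at this
    rw [this, Pi.one_apply]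
    split_ifs <;> simp
  have hmean : ∀ n : ℕ, n ≠ 0 → cesaro K x₀ n W ≤ V x₀ + C := by
    intro n hn
    have h1 := cesaro_mono (K := K) (x := x₀) hmono n (f := W) (g := V - K V + C • 1) fun x => by
      have := hdrift x
      simp only [Pi.add_apply, Pi.sub_apply, Pi.smul_apply, Pi.one_apply, smul_eq_mul, mul_one]
      linarith
    rw [map_add, map_sub, map_smul, cesaro_one hone hn, smul_eq_mul, mul_one] at h1
    have h2 := cesaro_sub (K := K) (x := x₀) n V
    have h3 : 0 ≤ (K ^ n) V x₀ := by
      simpa using markovOperator_pow_mono hmono n hV x₀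
    have h4 : (n : ℝ)⁻¹ ≤ 1 := Nat.cast_inv_le_one n
    have h5 : (n : ℝ)⁻¹ * (V x₀ - (K ^ n) V x₀) ≤ V x₀ := by
      have h6 : (n : ℝ)⁻¹ * (V x₀ - (K ^ n) V x₀) ≤ (n : ℝ)⁻¹ * V x₀ := by
        gcongr
        linarith
      exact h6.trans (mul_le_of_le_one_left (hV x₀) h4)
    linarith
  -- Tightness by Markov's inequality: the indicator of `W ≤ m` is at least `1 - W / m`, so no mass
  -- escapes to infinity.
  have hge : ∀ (m : ℝ), 0 < m → 1 - (V x₀ + C) / m ≤ ∑ y ∈ (hfin m).toFinset, p y := by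
    intro m hm
    have h := hcomb (hfin m).toFinset 1
    simp only [Pi.one_apply, one_mul] at h
    refine ge_of_tendsto h ?_
    filter_upwards [hn0] with n hn
    have h1 := cesaro_mono (K := K) (x := x₀) hmono n (f := 1 - m⁻¹ • W)
      (g := ∑ y ∈ (hfin m).toFinset, (1 : ℝ) • Pi.single y 1) fun x => by
        have := hsingle (hfin m).toFinset 1 x
        simp only [Pi.one_apply] at this
        rw [this]
        simp only [Pi.sub_apply, Pi.one_apply, Pi.smul_apply, smul_eq_mul, Set.Finite.mem_toFinset,
          Set.mem_ofPred_eq]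
        split_ifs with hx
        · have : 0 ≤ m⁻¹ * W x := mul_nonneg (inv_nonneg.mpr hm.le) (hW x)
          linarith
        · push Not at hx
          have : 1 ≤ m⁻¹ * W x := by
            rw [inv_mul_eq_div, le_div_iff₀ hm]
            linarith
          linarith
    refine le_trans ?_ h1
    rw [map_sub, map_smul, cesaro_one hone hn, smul_eq_mul, inv_mul_eq_div]
    gcongr
    exact hmean n hn
  refine ⟨p, fun x => (hp01 x).1, ?_, ?_⟩
  · refine hasSum_of_isLUB_of_nonneg _ (fun x => (hp01 x).1) ⟨?_, ?_⟩
    · rintro _ ⟨F, rfl⟩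
      exact hle F
    · intro b hb
      have h1 : Tendsto (fun m : ℝ => 1 - (V x₀ + C) / m) atTop (𝓝 (1 - 0)) :=
        (tendsto_const_nhds.div_atTop tendsto_id).const_sub 1
      rw [sub_zero] at h1
      refine le_of_tendsto h1 ?_
      filter_upwards [eventually_gt_atTop 0] with m hm
      exact (hge m hm).trans (hb ⟨_, rfl⟩)
  · intro y
    have h1 := hcomb (hcol y).toFinset (K (Pi.single y 1))
    -- Finite support makes the column a finite combination of indicators, the only functions whose
    -- limits are known so far.
    have e : ∑ z ∈ (hcol y).toFinset, K (Pi.single y 1) z • (Pi.single z 1 : S → ℝ) =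
        K (Pi.single y 1) := by
      ext x
      rw [hsingle]
      split_ifs with hx
      · rfl
      · simpa using (Eq.symm (by simpa using hx))
    rw [e] at h1
    have h2 : Tendsto (fun n : ℕ => (n : ℝ)⁻¹ * ((K ^ n) (Pi.single y 1) x₀ -
        (Pi.single y 1 : S → ℝ) x₀)) atTop (𝓝 0) := by
      refine squeeze_zero_norm (a := fun n : ℕ => (n : ℝ)⁻¹) (fun n => ?_)
        tendsto_inv_atTop_nhds_zero_nat
      rw [norm_mul, norm_inv, RCLike.norm_natCast]
      refine mul_le_of_le_one_right (by positivity) ?_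
      have a1 : 0 ≤ (K ^ n) (Pi.single y 1) x₀ := by
        simpa using markovOperator_pow_mono hmono n (hs0 y) x₀
      have a2 : (K ^ n) (Pi.single y 1) x₀ ≤ 1 := by
        have := markovOperator_pow_mono hmono n (hs1 y) x₀
        rwa [markovOperator_pow_one hone] at this
      have a3 := hs0 y x₀
      have a4 := hs1 y x₀
      simp only [Pi.zero_apply, Pi.one_apply] at a3 a4
      rw [Real.norm_eq_abs, abs_le]
      constructor <;> linarith
    have h3 := (h2.mono_left hU).add (hp y)
    simp only [← cesaro_sub, sub_add_cancel, zero_add] at h3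
    rw [← tendsto_nhds_unique h1 h3]
    simp only [mul_comm (p _)]
    refine hasSum_sum_of_ne_finset_zero fun x hx => ?_
    have : K (Pi.single y 1) x = 0 := by simpa using hx
    rw [this, zero_mul]

/-! ### Transitions of the queue -/

namespace State

theorem ξ_cases (s : State) : s.ξ = 0 ∧ s = empty ∨ s.ξ = 1 ∧ 1 ≤ s.n₁ ∨ s.ξ = 2 ∧ 1 ≤ s.n₂ := by
  obtain ⟨⟨i, j, k⟩, h⟩ := s
  rcases h with ⟨h0, h1, h2⟩ | h | h
  · simp only at h0 h1 h2
    subst h0 h1 h2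
    exact Or.inl ⟨rfl, rfl⟩
  · exact Or.inr (Or.inl h)
  · exact Or.inr (Or.inr h)

/-- The total number of customers in the system. -/
def total (s : State) : ℕ := s.n₁ + s.n₂

theorem finite_total_le (m : ℕ) : {s : State | s.total ≤ m}.Finite := by
  have h : (Set.Iic m ×ˢ Set.Iic m ×ˢ (Set.univ : Set (Fin 3))).Finite :=
    (Set.finite_Iic m).prod ((Set.finite_Iic m).prod Set.finite_univ)
  refine (h.preimage Subtype.val_injective.injOn).subset fun s hs => ?_
  have hs : s.1.1 + s.1.2.1 ≤ m := hs
  simp only [Set.mem_preimage, Set.mem_prod, Set.mem_Iic, Set.mem_univ, and_true]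
  omega

end State

@[simp] theorem ξ_empty : empty.ξ = 0 := rfl
@[simp] theorem n₁_empty : empty.n₁ = 0 := rfl
@[simp] theorem n₂_empty : empty.n₂ = 0 := rfl

section serving

variable (i j : ℕ)

@[simp] theorem ξ_serving₁ (h : 1 ≤ i) : (serving₁ i j h).ξ = 1 := rfl
@[simp] theorem n₁_serving₁ (h : 1 ≤ i) : (serving₁ i j h).n₁ = i := rfl
@[simp] theorem n₂_serving₁ (h : 1 ≤ i) : (serving₁ i j h).n₂ = j := rfl
@[simp] theorem ξ_serving₂ (h : 1 ≤ j) : (serving₂ i j h).ξ = 2 := rfl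
@[simp] theorem n₁_serving₂ (h : 1 ≤ j) : (serving₂ i j h).n₁ = i := rfl
@[simp] theorem n₂_serving₂ (h : 1 ≤ j) : (serving₂ i j h).n₂ = j := rfl

@[simp] theorem n₁_startNext : (startNext i j).n₁ = i := by
  unfold startNext
  split_ifs
  all_goals
    simp
    try omega

@[simp] theorem n₂_startNext : (startNext i j).n₂ = j := by
  unfold startNext
  split_ifs
  all_goals
    simp
    try omega

end serving

section transitions

variable (s : State)

@[simp] theorem n₁_arrive₁ : (arrive₁ s).n₁ = s.n₁ + 1 := by
  unfold arrive₁
  split_ifs <;> simp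

@[simp] theorem n₂_arrive₁ : (arrive₁ s).n₂ = s.n₂ := by
  unfold arrive₁
  split_ifs <;> simp

@[simp] theorem n₁_arrive₂ : (arrive₂ s).n₁ = s.n₁ := by
  unfold arrive₂
  split_ifs <;> simp

@[simp] theorem n₂_arrive₂ : (arrive₂ s).n₂ = s.n₂ + 1 := by
  unfold arrive₂
  split_ifs <;> simp

theorem n₁_complete : (complete s).n₁ = if s.ξ = 1 then s.n₁ - 1 else s.n₁ := by
  unfold complete
  split_ifs <;> simp

theorem n₂_complete : (complete s).n₂ = if s.ξ = 2 then s.n₂ - 1 else s.n₂ := by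
  unfold complete
  split_ifs with h1 h2
  · rw [h1] at h2
    exact absurd h2 (by decide)
  all_goals simp

theorem arrive₁_ne : arrive₁ s ≠ s := fun h => by
  have := congrArg State.n₁ h
  simp at this

theorem arrive₂_ne : arrive₂ s ≠ s := fun h => by
  have := congrArg State.n₂ h
  simp at this

end transitions

theorem arrive₁_empty : arrive₁ empty = serving₁ 1 0 le_rfl := rfl

theorem arrive₂_empty : arrive₂ empty = serving₂ 0 1 le_rfl := rfl

theorem arrive₁_serving₁ (i j : ℕ) (h : 1 ≤ i) :
    arrive₁ (serving₁ i j h) = serving₁ (i + 1) j (Nat.le_add_left 1 _) := by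
  simp [arrive₁]

theorem arrive₂_serving₁ (i j : ℕ) (h : 1 ≤ i) :
    arrive₂ (serving₁ i j h) = serving₁ i (j + 1) h := by
  simp [arrive₂, h]

theorem arrive₁_serving₂ (i j : ℕ) (h : 1 ≤ j) :
    arrive₁ (serving₂ i j h) = serving₂ (i + 1) j h := by
  simp [arrive₁, h]

theorem arrive₂_serving₂ (i j : ℕ) (h : 1 ≤ j) :
    arrive₂ (serving₂ i j h) = serving₂ i (j + 1) (Nat.le_add_left 1 _) := by
  simp [arrive₂]

/-- Every state can be reached from the empty system by arrivals. -/
theorem arrival_induction {C : State → Prop} (h0 : C empty) (h1 : ∀ s, C s → C (arrive₁ s))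
    (h2 : ∀ s, C s → C (arrive₂ s)) (s : State) : C s := by
  have c1 : ∀ i j, C (serving₁ (i + 1) j (Nat.le_add_left 1 _)) := by
    intro i j
    induction j with
    | zero =>
      induction i with
      | zero => exact arrive₁_empty ▸ h1 _ h0
      | succ i ih => exact arrive₁_serving₁ (i + 1) 0 _ ▸ h1 _ ih
    | succ j ih => exact arrive₂_serving₁ (i + 1) j _ ▸ h2 _ ih
  have c2 : ∀ i j, C (serving₂ i (j + 1) (Nat.le_add_left 1 _)) := by
    intro i j
    induction i with
    | zero =>
      induction j with
      | zero => exact arrive₂_empty ▸ h2 _ h0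
      | succ j ih => exact arrive₂_serving₂ 0 (j + 1) _ ▸ h2 _ ih
    | succ i ih => exact arrive₁_serving₂ i (j + 1) _ ▸ h1 _ ih
  rcases s.ξ_cases with ⟨_, rfl⟩ | ⟨hk, hi⟩ | ⟨hk, hj⟩
  · exact h0
  · obtain ⟨i, hi'⟩ := Nat.exists_eq_add_of_le' hi
    have := c1 i s.n₂
    convert this using 1
    exact Subtype.ext (Prod.ext hi' (Prod.ext rfl hk))
  · obtain ⟨j, hj'⟩ := Nat.exists_eq_add_of_le' hj
    have := c2 s.n₁ j
    convert this using 1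
    exact Subtype.ext (Prod.ext rfl (Prod.ext hj' hk))

/-! ### The generator -/

/-- The generator of the queue, acting on functions. -/
def generator (lam₁ lam₂ mu : ℝ) : (State → ℝ) →ₗ[ℝ] (State → ℝ) where
  toFun f x := lam₁ * (f (arrive₁ x) - f x) + lam₂ * (f (arrive₂ x) - f x) +
    (if x.ξ = 0 then 0 else mu) * (f (complete x) - f x)
  map_add' f g := by
    ext x
    simp only [Pi.add_apply]
    ring
  map_smul' c f := by
    ext x
    simp only [Pi.smul_apply, smul_eq_mul, RingHom.id_apply]
    ring

section rate

variable {lam₁ lam₂ mu : ℝ}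

theorem generator_apply (f : State → ℝ) (x : State) :
    generator lam₁ lam₂ mu f x = lam₁ * (f (arrive₁ x) - f x) + lam₂ * (f (arrive₂ x) - f x) +
      (if x.ξ = 0 then 0 else mu) * (f (complete x) - f x) := rfl

theorem generator_single (x y : State) :
    generator lam₁ lam₂ mu (Pi.single y 1) x = rate lam₁ lam₂ mu x y := by
  simp only [generator_apply, rate, Pi.single_apply, eq_comm (a := y)]

theorem hasSum_rate_mul (f : State → ℝ) (x : State) :
    HasSum (fun y => rate lam₁ lam₂ mu x y * f y) (generator lam₁ lam₂ mu f x) := by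
  have h : ∀ a : State, HasSum (fun y => (if y = a then 1 else 0) * f y) (f a) := fun a => by
    refine (hasSum_ite_eq a (f a)).congr_fun fun y => ?_
    split_ifs with hy
    · rw [hy, one_mul]
    · rw [zero_mul]
  refine (((((h (arrive₁ x)).sub (h x)).mul_left lam₁).add
    (((h (arrive₂ x)).sub (h x)).mul_left lam₂)).add
    (((h (complete x)).sub (h x)).mul_left (if x.ξ = 0 then 0 else mu))).congr_fun fun y => ?_
  unfold rate
  ring

theorem rate_nonneg_of_ne (h1 : 0 ≤ lam₁) (h2 : 0 ≤ lam₂) (hmu : 0 ≤ mu) {x y : State}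
    (h : y ≠ x) : 0 ≤ rate lam₁ lam₂ mu x y := by
  simp only [rate, if_neg h, sub_zero]
  positivity

theorem rate_arrive₁_pos (h1 : 0 < lam₁) (h2 : 0 ≤ lam₂) (hmu : 0 ≤ mu) (x : State) :
    0 < rate lam₁ lam₂ mu x (arrive₁ x) := by
  simp only [rate, if_neg (arrive₁_ne x), sub_zero, if_true]
  positivity

theorem rate_arrive₂_pos (h1 : 0 ≤ lam₁) (h2 : 0 < lam₂) (hmu : 0 ≤ mu) (x : State) :
    0 < rate lam₁ lam₂ mu x (arrive₂ x) := by
  simp only [rate, if_neg (arrive₂_ne x), sub_zero, if_true]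
  positivity

theorem neg_rate_self_le (h1 : 0 ≤ lam₁) (h2 : 0 ≤ lam₂) (hmu : 0 ≤ mu) (x : State) :
    -rate lam₁ lam₂ mu x x ≤ lam₁ + lam₂ + mu := by
  simp only [rate, if_true]
  split_ifs <;> linarith

theorem hasSum_abs_rate_bound (x : State) :
    HasSum (fun y : State => |lam₁| * ((if y = arrive₁ x then 1 else 0) + (if y = x then 1 else 0)) +
      |lam₂| * ((if y = arrive₂ x then 1 else 0) + (if y = x then 1 else 0)) +
      |mu| * ((if y = complete x then 1 else 0) + (if y = x then 1 else 0)))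
      (|lam₁| * (1 + 1) + |lam₂| * (1 + 1) + |mu| * (1 + 1)) := by
  have h : ∀ a : State, HasSum (fun y => (if y = a then 1 else 0 : ℝ)) 1 := fun a =>
    hasSum_ite_eq a 1
  exact ((((h _).add (h x)).mul_left _).add (((h _).add (h x)).mul_left _)).add
    (((h _).add (h x)).mul_left _)

theorem abs_rate_le (x y : State) : |rate lam₁ lam₂ mu x y| ≤
    |lam₁| * ((if y = arrive₁ x then 1 else 0) + (if y = x then 1 else 0)) +
      |lam₂| * ((if y = arrive₂ x then 1 else 0) + (if y = x then 1 else 0)) +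
      |mu| * ((if y = complete x then 1 else 0) + (if y = x then 1 else 0)) := by
  have h : ∀ a : State, |(if y = a then 1 else 0 : ℝ) - (if y = x then 1 else 0)| ≤
      (if y = a then 1 else 0) + (if y = x then 1 else 0) := fun a => by
    split_ifs <;> norm_num
  unfold rate
  refine (abs_add_le _ _).trans (add_le_add ((abs_add_le _ _).trans (add_le_add ?_ ?_)) ?_)
  · rw [abs_mul]
    exact mul_le_mul_of_nonneg_left (h _) (abs_nonneg _)
  · rw [abs_mul]
    exact mul_le_mul_of_nonneg_left (h _) (abs_nonneg _)
  · rw [abs_mul]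
    refine mul_le_mul ?_ (h _) (abs_nonneg _) (abs_nonneg _)
    split_ifs <;> simp

theorem hasSum_balance_mul {w f : State → ℝ} {B : ℝ} (hw : Summable w) (hf : ∀ y, |f y| ≤ B) :
    HasSum (fun y => (∑' x, w x * rate lam₁ lam₂ mu x y) * f y)
      (∑' x, w x * generator lam₁ lam₂ mu f x) := by
  have hb := fun x => hasSum_abs_rate_bound (lam₁ := lam₁) (lam₂ := lam₂) (mu := mu) x
  have hs : ∀ x, Summable fun y => |rate lam₁ lam₂ mu x y| := fun x =>
    Summable.of_nonneg_of_le (fun _ => abs_nonneg _) (abs_rate_le x) (hb x).summable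
  have h := hasSum_kernel (A := rate lam₁ lam₂ mu) hw hs
    (fun x => ((hs x).tsum_le_tsum (abs_rate_le x) (hb x).summable).trans (hb x).tsum_eq.le) hf
  simpa only [(hasSum_rate_mul f _).tsum_eq] using h

/-- Exchanging the two sums needs `f` bounded, which is why the counts are truncated in
`hasSum_server`. -/
theorem tsum_mul_generator {p f : State → ℝ} {B : ℝ}
    (hp : IsStationaryDistribution (rate lam₁ lam₂ mu) p) (hf : ∀ y, |f y| ≤ B) :
    ∑' x, p x * generator lam₁ lam₂ mu f x = 0 := by
  have h := hasSum_balance_mul (lam₁ := lam₁) (lam₂ := lam₂) (mu := mu) hp.hasSum_one.summable hf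
  simp only [(hp.balance _).tsum_eq, zero_mul] at h
  exact h.unique hasSum_zero

end rate

section stationary

variable {lam₁ lam₂ mu : ℝ}

/-! ### Existence -/

theorem exists_stationary (h1 : 0 < lam₁) (h2 : 0 < lam₂) (hmu : 0 < mu) (hρ : lam₁ + lam₂ < mu) :
    ∃ p, IsStationaryDistribution (rate lam₁ lam₂ mu) p := by
  set q := lam₁ + lam₂ + mu with hq
  have hq0 : 0 < q := by positivity
  -- At a busy state with `n` customers the drift of `n ^ 2` is `(lam₁ + lam₂)(2n + 1) + mu(1 - 2n)
  -- = q - 2(mu - lam₁ - lam₂)n`; division by `q` gives `1 - c n`.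
  set c := 2 * (mu - (lam₁ + lam₂)) / q with hc
  have hc0 : 0 < c := div_pos (by linarith) hq0
  -- Since `q` bounds every exit rate, the diagonal of this kernel stays nonnegative and `K` is a
  -- Markov operator.
  set K : (State → ℝ) →ₗ[ℝ] (State → ℝ) := LinearMap.id + q⁻¹ • generator lam₁ lam₂ mu with hK
  have hKa : ∀ f x, K f x = f x + q⁻¹ * generator lam₁ lam₂ mu f x := fun f x => by simp [hK]
  have hqK : ∀ f x, q * K f x = q * f x + generator lam₁ lam₂ mu f x := fun f x => by
    rw [hKa, mul_add, mul_inv_cancel_left₀ hq0.ne']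
  have hmono : ∀ f g, f ≤ g → K f ≤ K g := by
    intro f g hfg x
    have a0 := hfg x
    have a1 := mul_le_mul_of_nonneg_left (hfg (arrive₁ x)) h1.le
    have a2 := mul_le_mul_of_nonneg_left (hfg (arrive₂ x)) h2.le
    set r := if x.ξ = 0 then 0 else mu with hr
    have hr0 : 0 ≤ r := by rw [hr]; split_ifs <;> linarith
    have hr1 : r ≤ mu := by rw [hr]; split_ifs <;> linarith
    have a3 := mul_le_mul_of_nonneg_left (hfg (complete x)) hr0
    have a4 := mul_le_mul_of_nonneg_left a0 (sub_nonneg.mpr hr1)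
    refine le_of_mul_le_mul_left ?_ hq0
    rw [hqK, hqK, generator_apply, generator_apply, hq]
    linarith
  have hone : K 1 = 1 := by
    ext x
    rw [hKa, generator_apply]
    simp
  have hdrift : ∀ x, K (fun s => (s.total : ℝ) ^ 2) x ≤ (x.total : ℝ) ^ 2 - c * x.total + 1 := by
    intro x
    have e1 : (arrive₁ x).total = x.total + 1 := by simp [State.total]; ring
    have e2 : (arrive₂ x).total = x.total + 1 := by simp [State.total]; ring
    have hqc : q * c = 2 * (mu - (lam₁ + lam₂)) := mul_div_cancel₀ _ hq0.ne'
    refine le_of_mul_le_mul_left ?_ hq0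
    have e3 : q * ((x.total : ℝ) ^ 2 - c * x.total + 1) =
        q * (x.total : ℝ) ^ 2 - q * c * x.total + q := by ring
    rw [hqK, generator_apply, e3, hqc, e1, e2, hq]
    push_cast
    by_cases hx : x.ξ = 0
    · have : x.total = 0 := by
        rcases x.ξ_cases with ⟨_, rfl⟩ | ⟨hk, _⟩ | ⟨hk, _⟩
        · rfl
        all_goals rw [hk] at hx; exact absurd hx (by decide)
      rw [if_pos hx, this]
      simp only [Nat.cast_zero]
      linarith
    · have : (complete x).total + 1 = x.total := by
        rcases x.ξ_cases with ⟨h, _⟩ | ⟨hk, h⟩ | ⟨hk, h⟩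
        · exact absurd h hx
        all_goals simp [State.total, n₁_complete, n₂_complete, hk]; omega
      have : ((complete x).total : ℝ) = x.total - 1 := by
        rw [← this]; push_cast; ring
      rw [if_neg hx, this]
      linarith
  have hfin : ∀ m : ℝ, {x : State | c * x.total ≤ m}.Finite := by
    intro m
    refine (State.finite_total_le ⌊m / c⌋₊).subset fun s hs => ?_
    have hs : c * s.total ≤ m := hs
    exact Nat.le_floor (by rw [le_div_iff₀ hc0]; linarith)
  -- One event changes the total by at most one, so only finitely many states lead to `y`.
  have hcol : ∀ y, (Function.support (K (Pi.single y 1))).Finite := by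
    intro y
    refine (State.finite_total_le (y.total + 1)).subset fun x hx => ?_
    by_contra hxy
    have hxy : y.total + 1 < x.total := not_le.mp hxy
    refine hx ?_
    rw [hKa, generator_single]
    have n0 : ∀ z : State, x.total ≤ z.total + 1 → y ≠ z := by
      rintro z hz rfl
      omega
    have n1 := n0 x (by omega)
    have n2 := n0 (arrive₁ x) (by simp [State.total]; omega)
    have n3 := n0 (arrive₂ x) (by simp [State.total]; omega)
    have n4 := n0 (complete x) (by
      rcases x.ξ_cases with ⟨hk, h⟩ | ⟨hk, h⟩ | ⟨hk, h⟩
      all_goals simp [State.total, n₁_complete, n₂_complete, hk]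
      all_goals omega)
    simp [rate, n1, n2, n3, n4, n1.symm]
  obtain ⟨p, hp0, hp1, hpK⟩ := exists_invariant_of_drift hmono hone
    (V := fun s => (s.total : ℝ) ^ 2) (W := fun s => c * s.total) (C := 1)
    (fun s => sq_nonneg _) (fun s => mul_nonneg hc0.le (Nat.cast_nonneg _)) hdrift hfin hcol empty
  refine ⟨p, hp0, hp1, fun y => ?_⟩
  have e : HasSum (fun x => p x * (Pi.single y 1 : State → ℝ) x) (p y) := by
    refine (hasSum_ite_eq y (p y)).congr_fun fun x => ?_
    rw [Pi.single_apply]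
    split_ifs with hx
    · rw [hx, mul_one]
    · rw [mul_zero]
  have h := ((hpK y).sub e).mul_left q
  rw [sub_self, mul_zero] at h
  refine h.congr_fun fun x => ?_
  rw [hKa, generator_single]
  field_simp
  ring

/-! ### The state of the server -/

/-- If the arrival rate to the count `n` is `lam` and `n` decreases by one at the services of
class `k`, then in equilibrium the server serves class `k` with probability `lam / mu`. -/
theorem hasSum_server (hmu : 0 < mu) {p : State → ℝ}
    (hp : IsStationaryDistribution (rate lam₁ lam₂ mu) p) {n : State → ℕ} {k : Fin 3} {lam : ℝ}
    (hn : ∀ (m : ℕ) x, generator lam₁ lam₂ mu (fun y => (min (n y) m : ℕ)) x =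
      (if n x < m then lam else 0) - if x.ξ = k ∧ n x ≤ m then mu else 0) :
    HasSum ({s : State | s.ξ = k}.indicator p) (lam / mu) := by
  -- At `n x = m` an arrival leaves the truncated count unchanged while a departure still lowers it,
  -- hence `<` against `≤` in `hn`. Both restrictions disappear as `m → ∞`.
  have hlim : Tendsto (fun m : ℕ => ∑' x, p x * generator lam₁ lam₂ mu
      (fun y => (min (n y) m : ℕ)) x) atTop (𝓝 (∑' x, p x * (lam - if x.ξ = k then mu else 0))) := by
    refine tendsto_tsum_of_dominated_convergence (bound := fun x => p x * (|lam| + |mu|))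
      (hp.hasSum_one.summable.mul_right _) (fun x => ?_) (Eventually.of_forall fun m x => ?_)
    · refine tendsto_const_nhds.congr' ?_
      filter_upwards [eventually_gt_atTop (n x)] with m hm
      rw [hn, if_pos hm]
      simp only [hm.le, and_true]
    · rw [norm_mul, Real.norm_of_nonneg (hp.nonneg x), hn]
      refine mul_le_mul_of_nonneg_left ((norm_sub_le _ _).trans (add_le_add ?_ ?_)) (hp.nonneg x)
      all_goals split_ifs <;> simp
  have h0 : ∀ m : ℕ, ∑' x, p x * generator lam₁ lam₂ mu (fun y => (min (n y) m : ℕ)) x = 0 :=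
    fun m => tsum_mul_generator hp (B := m) fun y => by
      rw [Nat.abs_cast]
      exact_mod_cast min_le_right _ _
  simp only [h0] at hlim
  have hz := tendsto_nhds_unique hlim tendsto_const_nhds
  have hs : Summable fun x => p x * (lam - if x.ξ = k then mu else 0) := by
    refine Summable.of_norm_bounded (hp.hasSum_one.summable.mul_right (|lam| + |mu|)) fun x => ?_
    rw [norm_mul, Real.norm_of_nonneg (hp.nonneg x)]
    refine mul_le_mul_of_nonneg_left ((norm_sub_le _ _).trans (add_le_add le_rfl ?_)) (hp.nonneg x)
    split_ifs <;> simp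
  have h := ((hp.hasSum_one.mul_right lam).sub (hz ▸ hs.hasSum)).div_const mu
  rw [one_mul, sub_zero] at h
  refine h.congr_fun fun x => ?_
  by_cases hx : x.ξ = k
  · rw [Set.indicator_of_mem (show x ∈ {s : State | s.ξ = k} from hx), if_pos hx]
    field_simp
    ring
  · rw [Set.indicator_of_notMem (show x ∉ {s : State | s.ξ = k} from hx), if_neg hx]
    simp

theorem hasSum_server₁ (hmu : 0 < mu) {p : State → ℝ}
    (hp : IsStationaryDistribution (rate lam₁ lam₂ mu) p) :
    HasSum ({s : State | s.ξ = 1}.indicator p) (lam₁ / mu) := by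
  refine hasSum_server (n := State.n₁) hmu hp fun m x => ?_
  rw [generator_apply, n₁_arrive₁, n₁_arrive₂, n₁_complete, sub_self, mul_zero, add_zero,
    sub_eq_add_neg _ (ite _ _ _)]
  congr 1
  · rcases lt_or_ge x.n₁ m with h | h
    · rw [if_pos h, min_eq_left h.le, min_eq_left (by omega)]
      push_cast
      ring
    · rw [if_neg h.not_gt, min_eq_right h, min_eq_right (by omega)]
      ring
  · rcases x.ξ_cases with ⟨hk, h⟩ | ⟨hk, h⟩ | ⟨hk, h⟩
    · simp [hk]
    · obtain ⟨i, hi⟩ := Nat.exists_eq_add_of_le' h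
      rcases le_or_gt x.n₁ m with h | h
      · simp only [hk, h, and_self, if_true]
        rw [min_eq_left h, min_eq_left (by omega), hi]
        simp
      · simp only [hk, h.not_ge, and_false, if_true, if_false]
        rw [min_eq_right h.le, min_eq_right (by omega)]
        simp
    · simp [hk]

theorem hasSum_server₂ (hmu : 0 < mu) {p : State → ℝ}
    (hp : IsStationaryDistribution (rate lam₁ lam₂ mu) p) :
    HasSum ({s : State | s.ξ = 2}.indicator p) (lam₂ / mu) := by
  refine hasSum_server (n := State.n₂) hmu hp fun m x => ?_
  rw [generator_apply, n₂_arrive₁, n₂_arrive₂, n₂_complete, sub_self, mul_zero, zero_add,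
    sub_eq_add_neg _ (ite _ _ _)]
  congr 1
  · rcases lt_or_ge x.n₂ m with h | h
    · rw [if_pos h, min_eq_left h.le, min_eq_left (by omega)]
      push_cast
      ring
    · rw [if_neg h.not_gt, min_eq_right h, min_eq_right (by omega)]
      ring
  · rcases x.ξ_cases with ⟨hk, h⟩ | ⟨hk, h⟩ | ⟨hk, h⟩
    · simp [hk]
    · simp [hk]
    · obtain ⟨i, hi⟩ := Nat.exists_eq_add_of_le' h
      rcases le_or_gt x.n₂ m with h | h
      · simp only [hk, h, and_self, if_true]
        rw [min_eq_left h, min_eq_left (by omega), hi]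
        simp
      · simp only [hk, h.not_ge, and_false, if_true, if_false]
        rw [min_eq_right h.le, min_eq_right (by omega)]
        simp

theorem stationary_empty (hmu : 0 < mu) {p : State → ℝ}
    (hp : IsStationaryDistribution (rate lam₁ lam₂ mu) p) :
    p empty = (mu - lam₁ - lam₂) / mu := by
  have h := (hp.hasSum_one.sub (hasSum_server₁ hmu hp)).sub (hasSum_server₂ hmu hp)
  have h' : HasSum (fun x => if x = empty then p empty else 0) (1 - lam₁ / mu - lam₂ / mu) := by
    refine h.congr_fun fun x => ?_
    rcases x.ξ_cases with ⟨hk, rfl⟩ | ⟨hk, hn⟩ | ⟨hk, hn⟩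
    · simp [Set.indicator]
    all_goals
      have hx : x ≠ empty := by
        rintro rfl
        rw [ξ_empty] at hk
        exact absurd hk (by decide)
      simp [Set.indicator, hk, hx]
  rw [(hasSum_ite_eq empty (p empty)).unique h']
  field_simp

theorem hasSum_indicator_empty {p : State → ℝ} :
    HasSum ({s : State | s.ξ = 0}.indicator p) (p empty) := by
  refine (hasSum_ite_eq empty (p empty)).congr_fun fun x => ?_
  rcases x.ξ_cases with ⟨hk, rfl⟩ | ⟨hk, hn⟩ | ⟨hk, hn⟩
  · simp [Set.indicator]
  all_goals
    have hx : x ≠ empty := by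
      rintro rfl
      rw [ξ_empty] at hk
      exact absurd hk (by decide)
    simp [Set.indicator, hk, hx]

/-! ### Positivity and uniqueness -/

/-- If `p y = 0`, the negative diagonal term drops out of the balance equation at `y`, and a zero
sum of nonnegative inflows has only zero terms. -/
theorem stationary_pos_of_rate_pos (h1 : 0 ≤ lam₁) (h2 : 0 ≤ lam₂) (hmu : 0 ≤ mu) {p : State → ℝ}
    (hp : IsStationaryDistribution (rate lam₁ lam₂ mu) p) {x y : State} (hx : 0 < p x)
    (hxy : 0 < rate lam₁ lam₂ mu x y) : 0 < p y := by
  refine (hp.nonneg y).lt_of_ne' fun hy => ?_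
  have h0 : ∀ z, 0 ≤ p z * rate lam₁ lam₂ mu z y := fun z => by
    by_cases hz : y = z
    · rw [← hz, hy, zero_mul]
    · exact mul_nonneg (hp.nonneg z) (rate_nonneg_of_ne h1 h2 hmu hz)
  have := congrFun ((hasSum_zero_iff_of_nonneg h0).mp (hp.balance y)) x
  exact (mul_pos hx hxy).ne' this

theorem stationary_pos (h1 : 0 < lam₁) (h2 : 0 < lam₂) (hmu : 0 < mu) (hρ : lam₁ + lam₂ < mu)
    {p : State → ℝ} (hp : IsStationaryDistribution (rate lam₁ lam₂ mu) p) (x : State) :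
    0 < p x := by
  refine arrival_induction (C := fun x => 0 < p x) ?_ (fun s hs => ?_) (fun s hs => ?_) x
  · rw [stationary_empty hmu hp]
    exact div_pos (by linarith) hmu
  · exact stationary_pos_of_rate_pos h1.le h2.le hmu.le hp hs (rate_arrive₁_pos h1 h2.le hmu.le s)
  · exact stationary_pos_of_rate_pos h1.le h2.le hmu.le hp hs (rate_arrive₂_pos h1.le h2 hmu.le s)

/-- Arrivals lead from `empty` to both states; the symmetric closure spares any path back to
`empty`. -/
theorem eqvGen_rate (h1 : 0 < lam₁) (h2 : 0 < lam₂) (hmu : 0 < mu) (x z : State) :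
    Relation.EqvGen (fun a b => 0 < rate lam₁ lam₂ mu a b) x z := by
  have h : ∀ s, Relation.EqvGen (fun a b => 0 < rate lam₁ lam₂ mu a b) empty s := fun s =>
    arrival_induction (.refl _)
      (fun s hs => hs.trans _ _ _ (.rel _ _ (rate_arrive₁_pos h1 h2.le hmu.le s)))
      (fun s hs => hs.trans _ _ _ (.rel _ _ (rate_arrive₂_pos h1.le h2 hmu.le s))) s
  exact ((h x).symm _ _).trans _ _ _ (h z)

/-- By the triangle inequality `|p' - p|` has nonnegative net inflow at each state. These inflows
sum to zero because the generator kills constants, so all vanish and `|p' - p|` solves the balance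
equations. -/
theorem stationary_unique (h1 : 0 < lam₁) (h2 : 0 < lam₂) (hmu : 0 < mu) (hρ : lam₁ + lam₂ < mu)
    {p p' : State → ℝ} (hp : IsStationaryDistribution (rate lam₁ lam₂ mu) p)
    (hp' : IsStationaryDistribution (rate lam₁ lam₂ mu) p') : p' = p := by
  have hws : Summable fun x => |p' x - p x| :=
    (hp'.hasSum_one.summable.sub hp.hasSum_one.summable).abs
  have hwr : ∀ y, Summable fun x => |p' x - p x| * rate lam₁ lam₂ mu x y := fun y => by
    have := (((hp'.balance y).sub (hp.balance y)).summable).abs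
    refine this.of_norm_bounded fun x => ?_
    rw [← sub_mul, norm_mul, abs_mul, Real.norm_eq_abs, Real.norm_eq_abs, abs_abs]
  have hge : ∀ y, 0 ≤ ∑' x, |p' x - p x| * rate lam₁ lam₂ mu x y := by
    intro y
    -- With the sign at `y`, the diagonal terms agree exactly, so the negative diagonal rate does no
    -- harm.
    obtain ⟨σ, hσ, hy⟩ : ∃ σ : ℝ, |σ| = 1 ∧ |p' y - p y| = σ * (p' y - p y) := by
      rcases abs_cases (p' y - p y) with ⟨h, _⟩ | ⟨h, _⟩
      · exact ⟨1, by simp, by linarith⟩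
      · exact ⟨-1, by simp, by linarith⟩
    have h0 := ((hp'.balance y).sub (hp.balance y)).mul_left σ
    rw [sub_zero, mul_zero] at h0
    refine hasSum_le (fun x => ?_) h0 (hwr y).hasSum
    rw [← sub_mul, ← mul_assoc]
    by_cases hx : y = x
    · rw [← hx, hy]
    · refine mul_le_mul_of_nonneg_right ?_ (rate_nonneg_of_ne h1.le h2.le hmu.le hx)
      calc σ * (p' x - p x) ≤ |σ * (p' x - p x)| := le_abs_self _
        _ = |p' x - p x| := by rw [abs_mul, hσ, one_mul]
  have hz : ∀ y, ∑' x, |p' x - p x| * rate lam₁ lam₂ mu x y = 0 := by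
    have h := hasSum_balance_mul (lam₁ := lam₁) (lam₂ := lam₂) (mu := mu) hws (f := 1) (B := 1)
      (by simp)
    have e : ∀ x, generator lam₁ lam₂ mu 1 x = 0 := fun x => by simp [generator_apply]
    simp only [e, mul_zero, tsum_zero, Pi.one_apply, mul_one] at h
    exact fun y => congrFun ((hasSum_zero_iff_of_nonneg hge).mp h) y
  by_contra hne
  obtain ⟨x, hx⟩ := Function.ne_iff.mp hne
  set W := ∑' x, |p' x - p x| with hW
  have hW0 : 0 < W := hws.tsum_pos (fun _ => abs_nonneg _) x (abs_pos.mpr (sub_ne_zero.mpr hx))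
  have hd : IsStationaryDistribution (rate lam₁ lam₂ mu) fun x => |p' x - p x| / W := by
    refine ⟨fun x => div_nonneg (abs_nonneg _) hW0.le, ?_, fun y => ?_⟩
    · have h := hws.hasSum.div_const W
      rwa [← hW, div_self hW0.ne'] at h
    · have h := (hwr y).hasSum.div_const W
      rw [hz, zero_div] at h
      refine h.congr_fun fun x => ?_
      ring
  have h := stationary_pos h1 h2 hmu hρ hd empty
  simp only [stationary_empty hmu hp, stationary_empty hmu hp', sub_self, abs_zero, zero_div] at h
  exact lt_irrefl _ h

end stationary

/-! ### Convergence of the queue process -/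

theorem hasSum_real_preimage {Ω S : Type*} [MeasurableSpace Ω] [MeasurableSpace S] [Countable S]
    [MeasurableSingletonClass S] {ℙ : Measure Ω} [IsProbabilityMeasure ℙ] {Y : Ω → S}
    (hY : Measurable Y) {B : Set Ω} (hB : MeasurableSet B) :
    HasSum (fun s => ℙ.real (B ∩ {ω | Y ω = s})) (ℙ.real B) := by
  have hm : ∀ s, MeasurableSet (B ∩ {ω | Y ω = s}) := fun s =>
    hB.inter (hY (measurableSet_singleton s))
  have hd : Pairwise (Function.onFun Disjoint fun s => B ∩ {ω | Y ω = s}) := by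
    intro s s' hne
    refine Set.disjoint_left.mpr ?_
    rintro ω ⟨_, h⟩ ⟨_, h'⟩
    exact hne (h.symm.trans h')
  have hU : ⋃ s, B ∩ {ω | Y ω = s} = B := by
    ext ω
    simp
  have h := measure_iUnion (μ := ℙ) hd hm
  rw [hU] at h
  have hfin : ∑' s, ℙ (B ∩ {ω | Y ω = s}) ≠ ⊤ := h ▸ measure_ne_top ℙ B
  have h2 := ENNReal.hasSum_toReal hfin
  rw [← ENNReal.tsum_toReal_eq (fun s => measure_ne_top ℙ _), ← h] at h2
  exact h2

/-- The Markov property is needed only from time `0`, with the trivial event as past. -/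
theorem IsMarkovProcess.hasSum_law {Ω S : Type*} [MeasurableSpace Ω] [MeasurableSpace S]
    [Countable S] [MeasurableSingletonClass S] [DecidableEq S] {Q : S → S → ℝ} {ℙ : Measure Ω}
    [IsProbabilityMeasure ℙ] {X : ℝ≥0 → Ω → S} (hX : IsMarkovProcess Q ℙ X) :
    ∃ P, IsTransitionFunction Q P ∧ ∀ t y,
      HasSum (fun x => ℙ.real {ω | X 0 ω = x} * P t x y) (ℙ.real {ω | X t ω = y}) := by
  obtain ⟨hm, P, hP, h⟩ := hX
  refine ⟨P, hP, fun t y => ?_⟩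
  refine (hasSum_real_preimage (ℙ := ℙ) (hm 0) (hm t (measurableSet_singleton y))).congr_fun
    fun x => ?_
  have := h 0 t x y Set.univ MeasurableSet.univ
  rw [zero_add, Set.univ_inter] at this
  rw [← this, Set.inter_comm]
  rfl

/-- Convergence to an invariant distribution from every initial law. -/
theorem IsMarkovProcess.tendsto_law {Ω S : Type*} [MeasurableSpace Ω] [MeasurableSpace S]
    [Countable S] [MeasurableSingletonClass S] [DecidableEq S] {Q : S → S → ℝ} {ℙ : Measure Ω}
    [IsProbabilityMeasure ℙ] {X : ℝ≥0 → Ω → S} (hX : IsMarkovProcess Q ℙ X) {q : ℝ}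
    (hq : ∀ x, -Q x x ≤ q) {p : S → ℝ} (hp : IsStationaryDistribution Q p) (hp0 : ∀ x, 0 < p x)
    (hconn : ∀ x z, Relation.EqvGen (fun a b => 0 < Q a b) x z) (s : S) :
    Tendsto (fun t => ℙ.real {ω | X t ω = s}) atTop (𝓝 (p s)) := by
  obtain ⟨P, hP, hlaw⟩ := hX.hasSum_law
  have hinit : HasSum (fun x => ℙ.real {ω | X 0 ω = x}) 1 := by
    simpa using hasSum_real_preimage (ℙ := ℙ) (hX.1 0) MeasurableSet.univ
  have h : Tendsto (fun t => ∑' x, ℙ.real {ω | X 0 ω = x} * P t x s) atTop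
      (𝓝 (∑' x, ℙ.real {ω | X 0 ω = x} * p s)) := by
    refine tendsto_tsum_of_dominated_convergence (bound := fun x => ℙ.real {ω | X 0 ω = x})
      hinit.summable (fun x => ?_) (Eventually.of_forall fun t x => ?_)
    · exact (hP.tendsto_of_stationary hp0 hp.hasSum_one
        (fun t y => hP.hasSum_stationary hq hp t y) hconn x s).const_mul _
    · rw [norm_mul, Real.norm_of_nonneg measureReal_nonneg]
      exact mul_le_of_le_one_right measureReal_nonneg (hP.abs_le_one t x s)
  simpa only [(hlaw _ _).tsum_eq, tsum_mul_right, hinit.tsum_eq, one_mul] using h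

theorem tendsto_real_preimage {Ω S ι : Type*} [MeasurableSpace Ω] [MeasurableSpace S] [Countable S]
    [MeasurableSingletonClass S] {ℙ : Measure Ω} [IsProbabilityMeasure ℙ] {l : Filter ι}
    {X : ι → Ω → S} (hX : ∀ t, Measurable (X t)) {p : S → ℝ} (hp0 : ∀ s, 0 ≤ p s)
    (hp1 : HasSum p 1) (hp : ∀ s, Tendsto (fun t => ℙ.real {ω | X t ω = s}) l (𝓝 (p s)))
    (A : Set S) {a : ℝ} (ha : HasSum (A.indicator p) a) :
    Tendsto (fun t => ℙ.real (X t ⁻¹' A)) l (𝓝 a) := by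
  refine tendsto_of_hasSum_indicator (u := fun t s => ℙ.real {ω | X t ω = s})
    (fun t s => measureReal_nonneg) (fun t => ?_) hp0 hp1 hp A (fun t => ?_) ha
  · simpa using hasSum_real_preimage (ℙ := ℙ) (hX t) MeasurableSet.univ
  · refine (hasSum_real_preimage (ℙ := ℙ) (hX t) (hX t A.to_countable.measurableSet)).congr_fun
      fun s => ?_
    by_cases hs : s ∈ A
    · rw [Set.indicator_of_mem hs]
      congr 1
      ext ω
      simp only [Set.mem_inter_iff, Set.mem_preimage, Set.mem_ofPred_eq]
      exact ⟨fun h => ⟨h ▸ hs, h⟩, fun h => h.2⟩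
    · rw [Set.indicator_of_notMem hs]
      have : X t ⁻¹' A ∩ {ω | X t ω = s} = ∅ := by
        refine Set.eq_empty_of_forall_notMem ?_
        rintro ω ⟨h, rfl⟩
        exact hs h
      rw [this, measureReal_empty]

end PriorityQueue

/-! ### The theorem. -/

theorem theorem1 (lam₁ lam₂ mu : ℝ) (hlam₁ : 0 < lam₁) (hlam₂ : 0 < lam₂) (hmu : 0 < mu)
    (hρ : (lam₁ + lam₂) / mu < 1) :
    ∃ p : PriorityQueue.State → ℝ,
      -- `p` is the unique stationary distribution
      PriorityQueue.IsStationaryDistribution (PriorityQueue.rate lam₁ lam₂ mu) p ∧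
      (∀ p' : PriorityQueue.State → ℝ,
        PriorityQueue.IsStationaryDistribution (PriorityQueue.rate lam₁ lam₂ mu) p' → p' = p) ∧
      -- the stationary probabilities of the three states of the server
      HasSum (fun s : {s : PriorityQueue.State // s.ξ = 1} => p s) (lam₁ / mu) ∧
      HasSum (fun s : {s : PriorityQueue.State // s.ξ = 2} => p s) (lam₂ / mu) ∧
      p PriorityQueue.empty = (mu - lam₁ - lam₂) / mu ∧
      -- from every initial law, the queue converges to `p` and the state of the server
      -- converges to the three probabilities
      ∀ {Ω : Type*} [MeasurableSpace Ω] (ℙ : Measure Ω) [IsProbabilityMeasure ℙ]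
        (X : ℝ≥0 → Ω → PriorityQueue.State),
        PriorityQueue.IsPriorityQueue lam₁ lam₂ mu ℙ X →
          (∀ s, Tendsto (fun t => ℙ.real {ω | X t ω = s}) atTop (𝓝 (p s))) ∧
          Tendsto (fun t => ℙ.real {ω | (X t ω).ξ = 1}) atTop (𝓝 (lam₁ / mu)) ∧
          Tendsto (fun t => ℙ.real {ω | (X t ω).ξ = 2}) atTop (𝓝 (lam₂ / mu)) ∧
          Tendsto (fun t => ℙ.real {ω | (X t ω).ξ = 0}) atTop
            (𝓝 ((mu - lam₁ - lam₂) / mu)) := by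
  have hρ' : lam₁ + lam₂ < mu := by rwa [div_lt_one hmu] at hρ
  obtain ⟨p, hp⟩ := PriorityQueue.exists_stationary hlam₁ hlam₂ hmu hρ'
  have hs₁ := PriorityQueue.hasSum_server₁ hmu hp
  have hs₂ := PriorityQueue.hasSum_server₂ hmu hp
  have hs₀ := PriorityQueue.hasSum_indicator_empty (p := p)
  rw [PriorityQueue.stationary_empty hmu hp] at hs₀
  refine ⟨p, hp, fun p' hp' => PriorityQueue.stationary_unique hlam₁ hlam₂ hmu hρ' hp hp',
    hasSum_subtype_iff_indicator.mpr hs₁, hasSum_subtype_iff_indicator.mpr hs₂,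
    PriorityQueue.stationary_empty hmu hp, ?_⟩
  intro Ω _ ℙ _ X hX
  have hM : PriorityQueue.IsMarkovProcess (PriorityQueue.rate lam₁ lam₂ mu) ℙ X := hX
  have hlim := hM.tendsto_law (PriorityQueue.neg_rate_self_le hlam₁.le hlam₂.le hmu.le) hp
    (PriorityQueue.stationary_pos hlam₁ hlam₂ hmu hρ' hp)
    (PriorityQueue.eqvGen_rate hlam₁ hlam₂ hmu)
  have hset : ∀ (k : Fin 3) (a : ℝ), HasSum ({s : PriorityQueue.State | s.ξ = k}.indicator p) a →
      Tendsto (fun t => ℙ.real {ω | (X t ω).ξ = k}) atTop (𝓝 a) := fun k a ha =>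
    PriorityQueue.tendsto_real_preimage hM.1 hp.nonneg hp.hasSum_one hlim _ ha
  exact ⟨hlim, hset 1 _ hs₁, hset 2 _ hs₂, hset 0 _ hs₀⟩
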